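/- For an integer $s\ge 1$ call a subset of $\mathbb R^d$ $s$-convex if it is the union of $s$ convex sets (possibly empty or equal). Let $f(d,s,t)$ be the least integer $n$ such that every set $P$ of $n$ points in $\mathbb R^d$ has a partition $P=A\cup B$ for which every $s$-convex set containing $A$ intersects every $t$-convex set containing $B$. A finite set $S\subseteq\mathbb R^d$ is shattered by a family $E$ of subsets of $\mathbb R^d$ if every $T\subseteq S$ equals $e\cap S$ for some $e\in E$, and the VC-dimension of $(\mathbb R^d,E)$ is the largest size of a shattered set. A convex polytope with at most $s$ facets means here an intersection of at most $s$ closed halfspaces (it may be unbounded, and the intersection of no halfspaces is $\mathbb R^d$). Theorem. For all integers $d\ge 1$ and $s\ge 1$, the VC-dimension $l$ of $\mathbb R^d$ with respect to the convex polytopes with at most $s$ facets is finite, and $f(d,s,1)=l+1$. Moreover, $f(2,s,1)=2s+2$ for every $s\ge 1$, and $f(d,s,1)=\Theta(ds\log(s+1))$ for $d\ge 4$; that is, there are absolute constants $c,C>0$ such that $c\,ds\log(s+1)\le f(d,s,1)\le C\,ds\log(s+1)$ for all integers $d\ge 4$ and $s\ge 1$. -/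

import Mathlib

namespace UnionRadon

/-- A set in `ℝ^d` is `s`-convex if it is the union of `s` convex sets (which may be empty or
coincide). -/
def IsSConvex {d : ℕ} (s : ℕ) (C : Set (EuclideanSpace ℝ (Fin d))) : Prop :=
  ∃ X : Fin s → Set (EuclideanSpace ℝ (Fin d)), (∀ i, Convex ℝ (X i)) ∧ C = ⋃ i, X i

/-- Every set of exactly `n` points in `ℝ^d` has a partition `A ∪ B` such that every `s`-convex
set containing `A` meets every `t`-convex set containing `B`. -/
def HasUnionRadonPartitions (d s t n : ℕ) : Prop :=
  ∀ P : Finset (EuclideanSpace ℝ (Fin d)), P.card = n →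
    ∃ A B : Set (EuclideanSpace ℝ (Fin d)), A ∪ B = (P : Set (EuclideanSpace ℝ (Fin d))) ∧
      Disjoint A B ∧
      ∀ C D : Set (EuclideanSpace ℝ (Fin d)),
        IsSConvex s C → IsSConvex t D → A ⊆ C → B ⊆ D → (C ∩ D).Nonempty

/-- The number `f(d,s,t)`: the least `n` such that every set of `n` points in `ℝ^d` has a
partition `A ∪ B` such that every `s`-convex set containing `A` meets every `t`-convex set
containing `B`; it is `⊤` if there is no such `n`. -/
noncomputable def f (d s t : ℕ) : ℕ∞ :=
  ⨅ (n : ℕ) (_ : HasUnionRadonPartitions d s t n), (n : ℕ∞)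

/-- The finite set `S` of vertices is shattered by the family `E` of hyperedges. -/
def IsShattered {V : Type*} (E : Set (Set V)) (S : Finset V) : Prop :=
  ∀ T : Set V, T ⊆ (S : Set V) → ∃ e ∈ E, e ∩ (S : Set V) = T

/-- The VC-dimension of the hypergraph `(V, E)`: the largest size of a shattered finite set, and
`⊤` if there are shattered finite sets of arbitrarily large size. -/
noncomputable def vcDim {V : Type*} (E : Set (Set V)) : ℕ∞ :=
  ⨆ (S : Finset V) (_ : IsShattered E S), (S.card : ℕ∞)

/-- A closed halfspace `{x | ⟨a, x⟩ ≤ b}` of `ℝ^d`, with `a ≠ 0`. -/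
def IsClosedHalfspace {d : ℕ} (h : Set (EuclideanSpace ℝ (Fin d))) : Prop :=
  ∃ (a : EuclideanSpace ℝ (Fin d)) (b : ℝ), a ≠ 0 ∧ h = {x | inner ℝ a x ≤ b}

/-- The (possibly unbounded) convex polytopes in `ℝ^d` with at most `s` facets, that is, the
intersections of at most `s` closed halfspaces (the intersection of none is the whole space). -/
def polytopes (d s : ℕ) : Set (Set (EuclideanSpace ℝ (Fin d))) :=
  {K | ∃ m ≤ s, ∃ h : Fin m → Set (EuclideanSpace ℝ (Fin d)),
    (∀ i, IsClosedHalfspace (h i)) ∧ K = ⋂ i, h i}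

end UnionRadon

/-!
A partition `A ∪ B` of a finite set fails the Radon-type property for `t = 1` exactly when some
polytope with at most `s` facets contains `B` and misses `A`: a convex set around `B` is separated
from each of the `s` convex pieces around `A` by a halfspace, and the complement of a polytope with
`s` facets is a union of `s` convex sets. So all partitions of a set fail if and only if the set is
shattered by these polytopes (`hasUnionRadonPartitions_one_iff`), which gives `f d s 1 = l + 1` once
the VC-dimension `l` is finite (`exists_vcDim_eq_and_f_eq`).

Finiteness and the upper bound (`card_le_of_isShattered`) come from counting: by Radon's theorem
and the Sauer–Shelah lemma, halfspaces cut `N` points in at most `∑_{k ≤ d + 1} C(N, k)` ways, and a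
shattered set needs `2 ^ N` intersections of `s` such traces.

In the plane, `2 s + 1` points on a parabola are shattered (`exists_isShattered_plane`), since a subset
or its complement has at most `s` points, and either kind is cut out by `s` halfplanes. No `2 s + 2`
points are (`not_isShattered_plane`): they would be in convex position, and the alternate ones in their
cyclic order cannot be cut off by `s` halfplanes.

The lower bound for `d ≥ 4` (`exists_isShattered_card_ge`) rests on a family of `n 2 ^ (n - 1)` boxes
in the plane such that, for every subfamily, some `2 ^ n` points stab exactly its boxes. The boxes are
the switches of a butterfly network, and the points are the routes through it (`exists_switching`).
Adding one more dimension for each further abscissa multiplies the number of boxes, while the number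
of points stays the same. Boxes in dimension `D` and the points in them become points and orthants in
dimension `2 D`, and a finite configuration of orthants is linearised to halfspaces by exponentials
(`exists_isShattered_of_orthants`).
-/

namespace UnionRadon

/-! ### Radon-type partitions and shattering -/

/-- Strict separation by a closed halfspace. Either finite set may be empty; for the empty ones the
Hahn–Banach functional could vanish, so a coordinate functional takes its place. -/
theorem exists_closedHalfspace_superset_disjoint {d : ℕ} (hd : 1 ≤ d)
    {A B : Set (EuclideanSpace ℝ (Fin d))} (hA : A.Finite) (hB : B.Finite)
    (hAB : Disjoint (convexHull ℝ A) (convexHull ℝ B)) :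
    ∃ h, IsClosedHalfspace h ∧ B ⊆ h ∧ Disjoint A h := by
  have hne : (EuclideanSpace.single (⟨0, hd⟩ : Fin d) (1 : ℝ)) ≠ 0 := by
    intro h
    have := congrArg (fun v : EuclideanSpace ℝ (Fin d) => v ⟨0, hd⟩) h
    simp at this
  set e := EuclideanSpace.single (⟨0, hd⟩ : Fin d) (1 : ℝ)
  rcases A.eq_empty_or_nonempty with rfl | hA'
  · obtain ⟨b, hb⟩ := (hB.image (fun x => inner ℝ e x)).bddAbove
    exact ⟨_, ⟨e, b, hne, rfl⟩, fun x hx => hb (Set.mem_image_of_mem _ hx), by simp⟩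
  rcases B.eq_empty_or_nonempty with rfl | hB'
  · obtain ⟨b, hb⟩ := (hA.image (fun x => inner ℝ e x)).bddBelow
    refine ⟨_, ⟨e, b - 1, hne, rfl⟩, by simp, ?_⟩
    rw [Set.disjoint_left]
    intro x hx hx'
    have := hb (Set.mem_image_of_mem _ hx)
    simp only [Set.mem_ofPred_eq] at hx' this
    linarith
  obtain ⟨g, u, v, h1, huv, h2⟩ := geometric_hahn_banach_compact_closed (convex_convexHull ℝ B)
    (hB.isCompact_convexHull ℝ) (convex_convexHull ℝ A) (hA.isCompact_convexHull ℝ).isClosed hAB.symm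
  have key : ∀ x, inner ℝ ((InnerProductSpace.toDual ℝ _).symm g) x = g x := fun x => by
    simp
  refine ⟨_, ⟨(InnerProductSpace.toDual ℝ _).symm g, u, ?_, rfl⟩, ?_, ?_⟩
  · intro h0
    obtain ⟨a, ha⟩ := hA'
    obtain ⟨b, hb⟩ := hB'
    have e1 := h1 b (subset_convexHull ℝ B hb)
    have e2 := h2 a (subset_convexHull ℝ A ha)
    rw [← key, h0, inner_zero_left] at e1 e2
    linarith
  · intro x hx
    simp only [Set.mem_ofPred_eq, key]
    exact (h1 x (subset_convexHull ℝ B hx)).le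
  · rw [Set.disjoint_left]
    intro x hx hx'
    simp only [Set.mem_ofPred_eq, key] at hx'
    have := h2 x (subset_convexHull ℝ A hx)
    linarith

theorem convex_compl_closedHalfspace {d : ℕ} {h : Set (EuclideanSpace ℝ (Fin d))}
    (hh : IsClosedHalfspace h) : Convex ℝ hᶜ := by
  obtain ⟨a, b, -, rfl⟩ := hh
  have : {x | inner ℝ a x ≤ b}ᶜ = {x | b < innerSL ℝ a x} := by
    ext x; simp
  rw [this]
  exact convex_halfSpace_gt (innerSL ℝ a).toLinearMap.isLinear b

theorem convex_polytope {d s : ℕ} {e : Set (EuclideanSpace ℝ (Fin d))}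
    (he : e ∈ polytopes d s) : Convex ℝ e := by
  obtain ⟨m, -, h, hh, rfl⟩ := he
  refine convex_iInter fun i => ?_
  obtain ⟨a, b, -, hi⟩ := hh i
  rw [hi]
  exact convex_halfSpace_le (innerSL ℝ a).toLinearMap.isLinear b

/-- A partition `A ∪ B` is defeated by an `s`-convex set and a convex set exactly when a polytope with
at most `s` facets cuts `B` out of `A ∪ B`. One halfspace separates `B` from each of the `s` convex
pieces; conversely the complement of the polytope is the union of `s` open halfspaces. -/
theorem exists_disjoint_sConvex_iff {d : ℕ} (s : ℕ) (hd : 1 ≤ d)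
    {A B : Set (EuclideanSpace ℝ (Fin d))} (hA : A.Finite) (hB : B.Finite)
    (hAB : Disjoint A B) :
    (∃ C D : Set (EuclideanSpace ℝ (Fin d)), IsSConvex s C ∧ IsSConvex 1 D ∧ A ⊆ C ∧ B ⊆ D ∧
      Disjoint C D) ↔ ∃ e ∈ polytopes d s, e ∩ (A ∪ B) = B := by
  constructor
  · rintro ⟨C, D, ⟨X, hX, rfl⟩, ⟨Y, hY, rfl⟩, hAC, hBD, hCD⟩
    have hB0 : convexHull ℝ B ⊆ ⋃ i, Y i := by
      refine convexHull_min hBD ?_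
      have : (⋃ i, Y i) = Y 0 := by
        ext x; simp
      rw [this]; exact hY 0
    have : ∀ i, ∃ h, IsClosedHalfspace h ∧ B ⊆ h ∧ Disjoint (A ∩ X i) h := fun i => by
      refine exists_closedHalfspace_superset_disjoint hd (hA.subset Set.inter_subset_left) hB ?_
      refine hCD.mono ?_ hB0
      exact (convexHull_min Set.inter_subset_right (hX i)).trans (Set.subset_iUnion X i)
    choose h hh hBh hAh using this
    refine ⟨⋂ i, h i, ⟨s, le_rfl, h, hh, rfl⟩, ?_⟩
    ext x
    constructor
    · rintro ⟨hx, hxA | hxB⟩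
      · obtain ⟨i, hi⟩ := Set.mem_iUnion.1 (hAC hxA)
        exact ((Set.disjoint_left.1 (hAh i)) ⟨hxA, hi⟩ (Set.mem_iInter.1 hx i)).elim
      · exact hxB
    · intro hx
      exact ⟨Set.mem_iInter.2 fun i => hBh i hx, Or.inr hx⟩
  · rintro ⟨e, he, heB⟩
    have hc := convex_polytope he
    obtain ⟨m, hm, h, hh, rfl⟩ := he
    refine ⟨(⋂ i, h i)ᶜ, ⋂ i, h i,
      ⟨fun i => if hi : i.1 < m then (h ⟨i, hi⟩)ᶜ else ∅, ?_, ?_⟩, ⟨fun _ => ⋂ i, h i, fun _ => hc,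
        (Set.iUnion_const _).symm⟩,
      ?_, ?_, disjoint_compl_left⟩
    · intro i
      dsimp only
      split_ifs with hi
      · exact convex_compl_closedHalfspace (hh _)
      · exact convex_empty
    · ext x
      simp only [Set.mem_compl_iff, Set.mem_iInter, Set.mem_iUnion, not_forall]
      constructor
      · rintro ⟨i, hi⟩
        exact ⟨⟨i, i.2.trans_le hm⟩, by simpa using hi⟩
      · rintro ⟨i, hi⟩
        split_ifs at hi with him
        · exact ⟨_, hi⟩
        · exact hi.elim
    · intro x hx hxe
      exact Set.disjoint_left.1 hAB hx (heB ▸ (⟨hxe, Or.inl hx⟩ : x ∈ _ ∩ (A ∪ B)))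
    · exact (heB.symm.subset).trans Set.inter_subset_left

/-- For `t = 1` the Radon-type property says that no `n`-point set is shattered. -/
theorem hasUnionRadonPartitions_one_iff {d : ℕ} (s n : ℕ) (hd : 1 ≤ d) :
    HasUnionRadonPartitions d s 1 n ↔
      ∀ P : Finset (EuclideanSpace ℝ (Fin d)), P.card = n → ¬ IsShattered (polytopes d s) P := by
  refine forall₂_congr fun P _ => ?_
  constructor
  · rintro ⟨A, B, hP, hAB, h⟩ hS
    have hfin : (A ∪ B).Finite := hP ▸ P.finite_toSet
    obtain ⟨C, D, hC, hD, hAC, hBD, hCD⟩ := (exists_disjoint_sConvex_iff s hd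
      (hfin.subset Set.subset_union_left) (hfin.subset Set.subset_union_right) hAB).2
      (by rw [hP]; exact hS B (hP ▸ Set.subset_union_right))
    exact (h C D hC hD hAC hBD).ne_empty hCD.inter_eq
  · intro hS
    simp only [IsShattered, not_forall] at hS
    obtain ⟨T, hT, hno⟩ := hS
    refine ⟨↑P \ T, T, Set.sdiff_union_of_subset hT, Set.disjoint_sdiff_left, ?_⟩
    intro C D hC hD hAC hBD
    by_contra hne
    refine hno ?_
    have := (exists_disjoint_sConvex_iff s hd (P.finite_toSet.subset Set.sdiff_subset)
      (P.finite_toSet.subset hT) Set.disjoint_sdiff_left).1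
      ⟨C, D, hC, hD, hAC, hBD, Set.disjoint_iff_inter_eq_empty.2
        (Set.not_nonempty_iff_eq_empty.1 hne)⟩
    rwa [Set.sdiff_union_of_subset hT] at this

theorem IsShattered.subset {V : Type*} {E : Set (Set V)} {S S' : Finset V}
    (h : IsShattered E S) (hS : S' ⊆ S) : IsShattered E S' := by
  intro T hT
  obtain ⟨e, he, heS⟩ := h T (hT.trans (by exact_mod_cast hS))
  refine ⟨e, he, ?_⟩
  ext x
  have h1 := Set.ext_iff.1 heS x
  have h2 : x ∈ (S' : Set V) → x ∈ (S : Set V) := fun h => by exact_mod_cast hS h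
  have h3 := @hT x
  simp only [Set.mem_inter_iff] at *
  tauto

theorem isShattered_polytopes_empty (d s : ℕ) : IsShattered (polytopes d s) ∅ := by
  intro T hT
  refine ⟨Set.univ, ⟨0, Nat.zero_le _, Fin.elim0, fun i => i.elim0, by simp⟩, ?_⟩
  simpa using (Set.subset_empty_iff.1 (by simpa using hT)).symm

/-- A bound `N` on the sizes of shattered sets makes both invariants finite. Heredity of shattering
then turns the largest size `l` of a shattered set into `f d s 1 = l + 1`. -/
theorem exists_vcDim_eq_and_f_eq {d s N : ℕ} (hd : 1 ≤ d)
    (hN : ∀ S : Finset (EuclideanSpace ℝ (Fin d)), IsShattered (polytopes d s) S → S.card ≤ N) :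
    ∃ l : ℕ, l ≤ N ∧ vcDim (polytopes d s) = l ∧ f d s 1 = (l : ℕ∞) + 1 ∧
      ∀ S : Finset (EuclideanSpace ℝ (Fin d)), IsShattered (polytopes d s) S → S.card ≤ l := by
  set K : Set ℕ := {k | ∃ S : Finset (EuclideanSpace ℝ (Fin d)),
    IsShattered (polytopes d s) S ∧ S.card = k} with hK
  have hne : K.Nonempty := ⟨0, ∅, isShattered_polytopes_empty d s, rfl⟩
  have hbdd : BddAbove K := ⟨N, by rintro k ⟨S, hS, rfl⟩; exact hN S hS⟩
  obtain ⟨S₀, hS₀, hcard⟩ := Nat.sSup_mem hne hbdd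
  have hle : ∀ S : Finset (EuclideanSpace ℝ (Fin d)), IsShattered (polytopes d s) S →
      S.card ≤ sSup K := fun S hS => le_csSup hbdd ⟨S, hS, rfl⟩
  refine ⟨sSup K, hcard ▸ hN S₀ hS₀, ?_, ?_, hle⟩
  · refine le_antisymm (iSup₂_le fun S hS => by exact_mod_cast hle S hS) ?_
    rw [← hcard]
    exact le_iSup₂_of_le S₀ hS₀ le_rfl
  · refine le_antisymm (iInf₂_le_of_le (sSup K + 1) ?_ (by simp)) (le_iInf₂ fun n hn => ?_)
    · rw [hasUnionRadonPartitions_one_iff s _ hd]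
      intro P hP hS
      have := hle P hS
      omega
    · rw [hasUnionRadonPartitions_one_iff s _ hd] at hn
      by_contra hlt
      have hlt' : n ≤ S₀.card := by
        have : (n : ℕ∞) < ((sSup K + 1 : ℕ) : ℕ∞) := by push_cast; exact not_le.1 hlt
        have := Nat.cast_lt.1 this
        omega
      obtain ⟨P, hPS, hP⟩ := Finset.exists_subset_card_eq hlt'
      exact hn P hP (hS₀.subset hPS)

/-! ### The upper bound by counting traces -/

/-- The sets `{x | ⟨a, x⟩ ≤ b}`, where `a = 0` is allowed: these are the closed halfspaces together
with the whole space and the empty set. -/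
def weakHalfspace {d : ℕ} (a : EuclideanSpace ℝ (Fin d)) (b : ℝ) :
    Set (EuclideanSpace ℝ (Fin d)) := {x | inner ℝ a x ≤ b}

open Classical in
/-- The traces on `P` of all weak halfspaces. -/
noncomputable def halfspaceTraces {d : ℕ} (P : Finset (EuclideanSpace ℝ (Fin d))) :
    Finset (Finset P) :=
  {T | ∃ a b, ∀ x : P, x ∈ T ↔ (x : EuclideanSpace ℝ (Fin d)) ∈ weakHalfspace a b}

theorem mem_halfspaceTraces {d : ℕ} {P : Finset (EuclideanSpace ℝ (Fin d))} {T : Finset P} :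
    T ∈ halfspaceTraces P ↔
      ∃ a b, ∀ x : P, x ∈ T ↔ (x : EuclideanSpace ℝ (Fin d)) ∈ weakHalfspace a b := by
  simp [halfspaceTraces]

/-- By Radon's theorem, halfspaces shatter no `d + 2` points. -/
theorem vcDim_halfspaceTraces_le {d : ℕ} (P : Finset (EuclideanSpace ℝ (Fin d))) :
    (halfspaceTraces P).vcDim ≤ d + 1 := by
  classical
  refine Finset.sup_le fun S hS => ?_
  rw [Finset.mem_shatterer] at hS
  by_contra! hcard
  have hdep : ¬ AffineIndependent ℝ (fun x : S => ((x : P) : EuclideanSpace ℝ (Fin d))) := by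
    intro hind
    have := hind.card_le_finrank_succ
    have h2 := Submodule.finrank_le (vectorSpan ℝ (Set.range
      (fun x : S => ((x : P) : EuclideanSpace ℝ (Fin d)))))
    simp at this h2
    omega
  obtain ⟨I, z, hz1, hz2⟩ := Convex.radon_partition hdep
  obtain ⟨T, hT, hTS⟩ := hS (t := S.filter fun x => ∃ h : x ∈ S, (⟨x, h⟩ : S) ∈ I)
    (Finset.filter_subset _ _)
  obtain ⟨a, b, hab⟩ := mem_halfspaceTraces.1 hT
  have hmem : ∀ x : S, x ∈ I ↔ inner ℝ a ((x : P) : EuclideanSpace ℝ (Fin d)) ≤ b := by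
    intro x
    have h1 := Finset.ext_iff.1 hTS x
    have h2 := hab x
    simp only [Finset.mem_inter, Finset.mem_filter, weakHalfspace, Set.mem_ofPred_eq] at h1 h2
    rw [← h2]
    have := x.2
    constructor
    · intro hx; exact (h1.2 ⟨x.2, x.2, hx⟩).2
    · intro hx; obtain ⟨_, _, h⟩ := h1.1 ⟨x.2, hx⟩; exact h
  have e1 : inner ℝ a z ≤ b := by
    have : convexHull ℝ ((fun x : S => ((x : P) : EuclideanSpace ℝ (Fin d))) '' I) ⊆
        {y | innerSL ℝ a y ≤ b} := by
      refine convexHull_min ?_ (convex_halfSpace_le (innerSL ℝ a).toLinearMap.isLinear b)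
      rintro _ ⟨x, hx, rfl⟩
      simpa using (hmem x).1 hx
    simpa using this hz1
  have e2 : b < inner ℝ a z := by
    have : convexHull ℝ ((fun x : S => ((x : P) : EuclideanSpace ℝ (Fin d))) '' Iᶜ) ⊆
        {y | b < innerSL ℝ a y} := by
      refine convexHull_min ?_ (convex_halfSpace_gt (innerSL ℝ a).toLinearMap.isLinear b)
      rintro _ ⟨x, hx, rfl⟩
      have := (hmem x).not.1 hx
      simpa using this
    simpa using this hz2
  linarith

/-- A partial sum of binomial coefficients is bounded by the generating function: weighting the
`k`-th term by `t ^ (k - D) ≥ 1` leaves at most `t⁻ᴰ (1 + t) ^ N`. -/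
theorem sum_choose_le_pow_mul_exp {t : ℝ} (ht : 0 < t) (ht1 : t ≤ 1) (N D : ℕ) :
    ((∑ k ∈ Finset.Iic D, N.choose k : ℕ) : ℝ) ≤ (t⁻¹) ^ D * Real.exp (t * N) := by
  have h1 : (1 + t) ^ N ≤ Real.exp (t * N) := by
    rw [mul_comm, Real.exp_nat_mul]
    exact pow_le_pow_left₀ (by positivity) (by linarith [Real.add_one_le_exp t]) N
  have h2 : t ^ D * ((∑ k ∈ Finset.Iic D, N.choose k : ℕ) : ℝ) ≤ (1 + t) ^ N := by
    rw [add_comm, add_pow]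
    push_cast
    rw [Finset.mul_sum]
    calc ∑ k ∈ Finset.Iic D, t ^ D * (N.choose k : ℝ)
        ≤ ∑ k ∈ Finset.Iic D, t ^ k * (N.choose k : ℝ) := by
          refine Finset.sum_le_sum fun k hk => ?_
          exact mul_le_mul_of_nonneg_right
            (pow_le_pow_of_le_one ht.le ht1 (Finset.mem_Iic.1 hk)) (by positivity)
      _ = ∑ k ∈ (Finset.Iic D).filter (· ≤ N), t ^ k * (N.choose k : ℝ) := by
          rw [Finset.sum_filter]
          refine Finset.sum_congr rfl fun k _ => ?_
          split_ifs with h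
          · rfl
          · rw [Nat.choose_eq_zero_of_lt (not_le.1 h)]; simp
      _ ≤ ∑ k ∈ Finset.range (N + 1), t ^ k * (N.choose k : ℝ) := by
          refine Finset.sum_le_sum_of_subset_of_nonneg ?_ fun _ _ _ => by positivity
          intro k hk
          simp only [Finset.mem_filter, Finset.mem_range] at hk ⊢
          omega
      _ = _ := by simp
  rw [inv_pow, inv_mul_eq_div, le_div_iff₀ (by positivity), mul_comm]
  exact h2.trans h1

theorem card_halfspaceTraces_le {d : ℕ} (P : Finset (EuclideanSpace ℝ (Fin d))) :
    (halfspaceTraces P).card ≤ ∑ k ∈ Finset.Iic (d + 1), P.card.choose k := by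
  classical
  calc (halfspaceTraces P).card ≤ (halfspaceTraces P).shatterer.card :=
        Finset.card_le_card_shatterer _
    _ ≤ ∑ k ∈ Finset.Iic (halfspaceTraces P).vcDim, (Fintype.card P).choose k :=
        Finset.card_shatterer_le_sum_vcDim
    _ ≤ _ := by
        rw [Fintype.card_coe]
        exact Finset.sum_le_sum_of_subset
          (Finset.Iic_subset_Iic.2 (vcDim_halfspaceTraces_le P))

/-- Each subset of a shattered set is an intersection of `s` halfspace traces. -/
theorem two_pow_card_le_of_isShattered {d s : ℕ} {P : Finset (EuclideanSpace ℝ (Fin d))}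
    (hP : IsShattered (polytopes d s) P) :
    2 ^ P.card ≤ (halfspaceTraces P).card ^ s := by
  classical
  have key : ∀ T : Finset P, ∃ g : Fin s → halfspaceTraces P,
      ∀ x, x ∈ T ↔ ∀ i, x ∈ (g i : Finset P) := by
    intro T
    obtain ⟨e, ⟨m, hm, h, hh, rfl⟩, he⟩ := hP ((↑) '' (T : Set P)) (by
      rintro _ ⟨x, -, rfl⟩; exact x.2)
    choose a b hab using hh
    refine ⟨fun i => if hi : i.1 < m then
      ⟨Finset.univ.filter fun x : P => (x : EuclideanSpace ℝ (Fin d)) ∈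
        weakHalfspace (a ⟨i, hi⟩) (b ⟨i, hi⟩), mem_halfspaceTraces.2
        ⟨a ⟨i, hi⟩, b ⟨i, hi⟩, by simp⟩⟩
      else ⟨Finset.univ, mem_halfspaceTraces.2 ⟨0, 0, by simp [weakHalfspace]⟩⟩, ?_⟩
    intro x
    have h1 := Set.ext_iff.1 he x
    have h2 : (x : EuclideanSpace ℝ (Fin d)) ∈ ((↑) '' (T : Set P) :
        Set (EuclideanSpace ℝ (Fin d))) ↔ x ∈ T := by simp
    rw [← h2, ← h1]
    have hx : (x : EuclideanSpace ℝ (Fin d)) ∈ (P : Set (EuclideanSpace ℝ (Fin d))) := x.2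
    simp only [Set.mem_inter_iff, hx, and_true, Set.mem_iInter]
    constructor
    · intro H i
      split_ifs with hi
      · have := H ⟨i, hi⟩
        rw [(hab _).2] at this
        exact Finset.mem_filter.2 ⟨Finset.mem_univ _, this⟩
      · simp
    · intro H i
      have := H ⟨i, i.2.trans_le hm⟩
      rw [(hab _).2]
      rw [dif_pos i.2] at this
      exact (Finset.mem_filter.1 this).2
  choose g hg using key
  have hinj : Function.Injective g := fun T T' hTT => by
    ext x; rw [hg, hg, hTT]
  have := Fintype.card_le_of_injective g hinj
  simpa using this

/-- The upper bound on the VC-dimension of polytopes with few facets, from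
`2 ^ N ≤ (number of halfspace traces) ^ s`. -/
theorem card_le_of_isShattered {d s : ℕ} (hs : 1 ≤ s) {P : Finset (EuclideanSpace ℝ (Fin d))}
    (hP : IsShattered (polytopes d s) P) :
    (P.card : ℝ) ≤ 5 * s * (d + 1) * Real.log (s + 1) := by
  have hs' : (1 : ℝ) ≤ s := by exact_mod_cast hs
  set N : ℝ := (P.card : ℝ)
  -- With `t = 1 / (4 s)` the exponential factors contribute only `N / 4 < N log 2` after taking
  -- logarithms.
  have hT : ((halfspaceTraces P).card : ℝ) ≤
      (4 * (s : ℝ)) ^ (d + 1) * Real.exp ((4 * s : ℝ)⁻¹ * N) := by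
    have := sum_choose_le_pow_mul_exp (t := (4 * s : ℝ)⁻¹) (by positivity)
      (inv_le_one_of_one_le₀ (by linarith)) P.card (d + 1)
    rw [inv_inv] at this
    exact (Nat.cast_le.2 (card_halfspaceTraces_le P)).trans this
  have h2 : (2 : ℝ) ^ P.card ≤ ((4 * (s : ℝ)) ^ (d + 1) * Real.exp ((4 * s : ℝ)⁻¹ * N)) ^ s := by
    calc (2 : ℝ) ^ P.card ≤ ((halfspaceTraces P).card : ℝ) ^ s := by
          exact_mod_cast two_pow_card_le_of_isShattered hP
      _ ≤ _ := pow_le_pow_left₀ (by positivity) hT s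
  have h3 := Real.log_le_log (by positivity) h2
  rw [Real.log_pow, Real.log_pow, Real.log_mul (by positivity) (by positivity), Real.log_pow,
    Real.log_exp] at h3
  have h4 : Real.log (4 * s) ≤ 2 * Real.log (s + 1) := by
    have h2log : 2 * Real.log ((s : ℝ) + 1) = Real.log (((s : ℝ) + 1) ^ 2) := by
      rw [Real.log_pow]; norm_num
    rw [h2log]
    refine Real.log_le_log (by positivity) ?_
    nlinarith [sq_nonneg ((s : ℝ) - 1)]
  have h5 : (s : ℝ) * ((4 * s : ℝ)⁻¹ * N) = N / 4 := by field_simp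
  have h6 : N * (0.44 : ℝ) ≤ s * ((d + 1 : ℕ) * (2 * Real.log (s + 1))) := by
    have hN : 0 ≤ N := Nat.cast_nonneg _
    have hl := Real.log_two_gt_d9
    have : (s : ℝ) * ((d + 1 : ℕ) * Real.log (4 * s)) ≤
      s * ((d + 1 : ℕ) * (2 * Real.log (s + 1))) := by gcongr
    rw [mul_add, h5] at h3
    nlinarith
  have h7 : 0 ≤ (s : ℝ) * (d + 1) * Real.log (s + 1) := by
    have := Real.log_nonneg (show (1 : ℝ) ≤ s + 1 by linarith)
    positivity
  push_cast at h6
  linarith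

/-! ### Polygons in the plane -/

theorem biInter_mem_polytopes {d s : ℕ} {κ : Type*} (F : Finset κ) (hF : F.card ≤ s)
    (h : κ → Set (EuclideanSpace ℝ (Fin d))) (hh : ∀ k ∈ F, IsClosedHalfspace (h k)) :
    (⋂ k ∈ F, h k) ∈ polytopes d s := by
  refine ⟨F.card, hF, fun i => h (F.equivFin.symm i), fun i => hh _ (F.equivFin.symm i).2, ?_⟩
  ext x
  simp only [Set.mem_iInter]
  constructor
  · intro H i
    exact H _ (F.equivFin.symm i).2
  · intro H k hk
    simpa using H (F.equivFin ⟨k, hk⟩)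

/-- The point of abscissa `i` on the standard parabola. -/
noncomputable def parabolaPoint (i : ℕ) : EuclideanSpace ℝ (Fin 2) := !₂[(i : ℝ), (i : ℝ) ^ 2]

theorem parabolaPoint_injective : Function.Injective parabolaPoint := by
  intro i j h
  have := congrArg (fun v : EuclideanSpace ℝ (Fin 2) => v 0) h
  simpa [parabolaPoint] using this

/-- A quadratic inequality on the abscissa cuts the parabola by a halfplane. -/
theorem exists_closedHalfspace_parabola (α β γ : ℝ) (hα : α ≠ 0) :
    ∃ h, IsClosedHalfspace h ∧
      ∀ i, parabolaPoint i ∈ h ↔ α * (i : ℝ) ^ 2 + β * i + γ ≤ 0 := by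
  refine ⟨_, ⟨!₂[β, α], -γ, ?_, rfl⟩, fun i => ?_⟩
  · intro h
    have := congrArg (fun v : EuclideanSpace ℝ (Fin 2) => v 1) h
    exact hα (by simpa using this)
  · simp only [Set.mem_ofPred_eq, PiLp.inner_apply, Fin.sum_univ_two, parabolaPoint]
    simp
    constructor <;> intro h <;> linarith

/-- At most `s` points of the parabola are cut off one by one, each near its own tangent. -/
theorem exists_polytope_parabola_of_card_compl_le {s : ℕ} (A : Finset ℕ) (hA : A.card ≤ s) :
    ∃ e ∈ polytopes 2 s, ∀ i, parabolaPoint i ∈ e ↔ i ∉ A := by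
  choose h hh hmem using fun a : ℕ =>
    exists_closedHalfspace_parabola (-1) (2 * a) (1 / 2 - (a : ℝ) ^ 2) (by norm_num)
  refine ⟨_, biInter_mem_polytopes A hA h fun a _ => hh a, fun i => ?_⟩
  simp only [Set.mem_iInter, hmem]
  constructor
  · intro H hi
    have := H i hi
    nlinarith
  · intro hi a ha
    have h1 : (1 : ℝ) ≤ ((i : ℝ) - a) ^ 2 := by
      have hne : (i : ℤ) - a ≠ 0 := by
        intro h0
        have : i = a := by omega
        exact hi (this ▸ ha)
      have h2 : 0 < ((i : ℤ) - a) ^ 2 := by positivity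
      have h2 : 1 ≤ ((i : ℤ) - a) ^ 2 := h2
      exact_mod_cast h2
    nlinarith

/-- At most `s` points of the parabola are cut out by the edges of their convex hull: one chord for
each pair of neighbours, which removes the points between them, and the chord of the extreme points,
which removes the points outside. A single point gets its tangent. -/
theorem exists_polytope_parabola_of_card_le {s : ℕ} (hs : 1 ≤ s) (B : Finset ℕ) (hB : B.card ≤ s) :
    ∃ e ∈ polytopes 2 s, ∀ i, parabolaPoint i ∈ e ↔ i ∈ B := by
  classical
  rcases B.eq_empty_or_nonempty with rfl | hne
  · obtain ⟨h, hh, hmem⟩ := exists_closedHalfspace_parabola 1 0 1 one_ne_zero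
    refine ⟨_, biInter_mem_polytopes {()} (by simpa using hs) (fun _ => h) fun _ _ => hh,
      fun i => iff_of_false (fun H => ?_) (Finset.notMem_empty i)⟩
    have := (hmem i).1 (Set.mem_iInter₂.1 H () (Finset.mem_singleton_self _))
    nlinarith
  set M := B.max' hne
  set m := B.min' hne
  -- The halfplane of `b` is bounded by the chord to its successor `c` in `B`; the maximum of `B`, which
  -- has no successor, is assigned the chord from `m` to `M`.
  have hcut : ∀ b, ∃ h, IsClosedHalfspace h ∧ ∀ i, parabolaPoint i ∈ h ↔
      if hb : (B.filter (b < ·)).Nonempty then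
        0 ≤ ((i : ℝ) - b) * ((i : ℝ) - ((B.filter (b < ·)).min' hb : ℕ))
      else ((i : ℝ) - m) * ((i : ℝ) - M) ≤ 0 := by
    intro b
    split_ifs with hb
    · set c : ℕ := (B.filter (b < ·)).min' hb
      obtain ⟨h, hh, hmem⟩ := exists_closedHalfspace_parabola (-1) (b + c) (-(b * c)) (by norm_num)
      refine ⟨h, hh, fun i => (hmem i).trans ?_⟩
      constructor <;> intro h <;> nlinarith
    · obtain ⟨h, hh, hmem⟩ := exists_closedHalfspace_parabola 1 (-(m + M)) (m * M) (by norm_num)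
      refine ⟨h, hh, fun i => (hmem i).trans ?_⟩
      constructor <;> intro h <;> nlinarith
  choose h hh hmem using hcut
  refine ⟨_, biInter_mem_polytopes B hB h fun b _ => hh b, fun i => ?_⟩
  simp only [Set.mem_iInter, hmem]
  constructor
  · intro H
    by_contra hi
    have hM : ¬ (B.filter (M < ·)).Nonempty := by
      rintro ⟨x, hx⟩
      rw [Finset.mem_filter] at hx
      exact (B.le_max' x hx.1).not_gt hx.2
    have h1 := H M (B.max'_mem hne)
    rw [dif_neg hM] at h1
    by_cases hlt : (B.filter (· < i)).Nonempty
    · -- `b` and `c` are the neighbours of `i` in `B`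
      set b := (B.filter (· < i)).max' hlt
      obtain ⟨hbB, hbi⟩ := Finset.mem_filter.1 ((B.filter (· < i)).max'_mem hlt)
      by_cases hgt : (B.filter (b < ·)).Nonempty
      · have h2 := H b hbB
        rw [dif_pos hgt] at h2
        set c := (B.filter (b < ·)).min' hgt
        obtain ⟨hcB, hbc⟩ := Finset.mem_filter.1 ((B.filter (b < ·)).min'_mem hgt)
        have hic : i < c := by
          by_contra! hle
          have hci : c < i := lt_of_le_of_ne hle fun h => hi (h ▸ hcB)
          exact ((B.filter (· < i)).le_max' c (Finset.mem_filter.2 ⟨hcB, hci⟩)).not_gt hbc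
        have e1 : (b : ℝ) < i := by exact_mod_cast hbi
        have e2 : (i : ℝ) < c := by exact_mod_cast hic
        nlinarith
      · have hMi : M < i := by
          have : M ≤ b := not_lt.1 fun h => hgt ⟨M, Finset.mem_filter.2 ⟨B.max'_mem hne, h⟩⟩
          exact this.trans_lt hbi
        have hmi : m < i := (B.min'_le _ hbB).trans_lt hbi
        have e1 : (M : ℝ) < i := by exact_mod_cast hMi
        have e2 : (m : ℝ) < i := by exact_mod_cast hmi
        nlinarith
    · have hall : ∀ b ∈ B, i < b := fun b hb => by
        refine lt_of_le_of_ne (not_lt.1 fun h => hlt ⟨b, Finset.mem_filter.2 ⟨hb, h⟩⟩) ?_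
        rintro rfl
        exact hi hb
      have e1 : (i : ℝ) < M := by exact_mod_cast hall _ (B.max'_mem hne)
      have e2 : (i : ℝ) < m := by exact_mod_cast hall _ (B.min'_mem hne)
      nlinarith
  · intro hi b hb
    split_ifs with hgt
    · set c := (B.filter (b < ·)).min' hgt
      obtain ⟨hcB, hbc⟩ := Finset.mem_filter.1 ((B.filter (b < ·)).min'_mem hgt)
      have e0 : (b : ℝ) < c := by exact_mod_cast hbc
      rcases le_or_gt i b with hib | hib
      · have e1 : (i : ℝ) ≤ b := by exact_mod_cast hib
        nlinarith
      · have e1 : (b : ℝ) < i := by exact_mod_cast hib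
        have e2 : (c : ℝ) ≤ i := by
          exact_mod_cast (B.filter (b < ·)).min'_le i (Finset.mem_filter.2 ⟨hi, hib⟩)
        nlinarith
    · have e1 : (i : ℝ) ≤ M := by exact_mod_cast B.le_max' i hi
      have e2 : (m : ℝ) ≤ i := by exact_mod_cast B.min'_le i hi
      nlinarith

/-- Among `2 s + 1` points of the parabola, a subset or its complement has at most `s` points. -/
theorem exists_isShattered_plane {s : ℕ} (hs : 1 ≤ s) :
    ∃ P : Finset (EuclideanSpace ℝ (Fin 2)), P.card = 2 * s + 1 ∧
      IsShattered (polytopes 2 s) P := by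
  classical
  refine ⟨(Finset.range (2 * s + 1)).map ⟨parabolaPoint, parabolaPoint_injective⟩, by simp, ?_⟩
  intro T hT
  set B := (Finset.range (2 * s + 1)).filter (parabolaPoint · ∈ T)
  set A := (Finset.range (2 * s + 1)).filter (parabolaPoint · ∉ T)
  have hcard : B.card + A.card = 2 * s + 1 := by
    rw [Finset.card_filter_add_card_filter_not, Finset.card_range]
  obtain ⟨e, he, hmem⟩ : ∃ e ∈ polytopes 2 s, ∀ i ∈ Finset.range (2 * s + 1),
      parabolaPoint i ∈ e ↔ parabolaPoint i ∈ T := by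
    rcases le_or_gt A.card s with hA | hA
    · obtain ⟨e, he, hmem⟩ := exists_polytope_parabola_of_card_compl_le A hA
      exact ⟨e, he, fun i hi => by rw [hmem, Finset.mem_filter]; tauto⟩
    · obtain ⟨e, he, hmem⟩ := exists_polytope_parabola_of_card_le hs B (by omega)
      exact ⟨e, he, fun i hi => by rw [hmem, Finset.mem_filter]; tauto⟩
  refine ⟨e, he, ?_⟩
  ext x
  constructor
  · rintro ⟨hxe, hx⟩
    obtain ⟨i, hi, rfl⟩ := Finset.mem_map.1 (Finset.mem_coe.1 hx)
    exact (hmem i hi).1 hxe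
  · intro hx
    have hx' := hT hx
    obtain ⟨i, hi, rfl⟩ := Finset.mem_map.1 (Finset.mem_coe.1 hx')
    exact ⟨(hmem i hi).2 hx, hx'⟩

/-- Let `q` lie strictly inside the angle at `o` spanned by `p` and `r`. Then `q` is in the triangle
`o p r`, or the segments `o q` and `p r` cross, according to the side of the line `p r` on which `q`
lies. -/
theorem mem_convexHull_or_segments_meet {V : Type*} [AddCommGroup V] [Module ℝ V]
    {o p q r : V} {x y z : ℝ} (hx : 0 < x) (hy : 0 < y) (hz : 0 < z)
    (h : z • (q - o) = y • (p - o) + x • (r - o)) :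
    q ∈ convexHull ℝ {o, p, r} ∨ (segment ℝ o q ∩ segment ℝ p r).Nonempty := by
  rcases le_or_gt (x + y) z with hle | hlt
  · left
    have hq : q = (1 - (x + y) / z) • o + (y / z) • p + (x / z) • r := by
      have h1 : q - o = z⁻¹ • (y • (p - o) + x • (r - o)) := by
        rw [← h, smul_smul, inv_mul_cancel₀ hz.ne', one_smul]
      rw [← sub_add_cancel q o, h1]
      match_scalars <;> field_simp
      ring
    rw [convexHull_insert (by simp), convexHull_pair, hq]
    rw [mem_convexJoin]
    refine ⟨o, rfl, (y / (x + y)) • p + (x / (x + y)) • r, ?_, ?_⟩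
    · exact ⟨y / (x + y), x / (x + y), by positivity, by positivity, by field_simp; ring, rfl⟩
    · refine ⟨1 - (x + y) / z, (x + y) / z, ?_, by positivity, by ring, ?_⟩
      · rw [sub_nonneg, div_le_one hz]; exact hle
      · match_scalars <;> field_simp
  · right
    refine ⟨(1 - z / (x + y)) • o + (z / (x + y)) • q, ?_, ?_⟩
    · refine ⟨1 - z / (x + y), z / (x + y), ?_, by positivity, by ring, rfl⟩
      rw [sub_nonneg, div_le_one (by positivity)]; exact hlt.le
    · refine ⟨y / (x + y), x / (x + y), by positivity, by positivity, by field_simp; ring, ?_⟩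
      have h1 : (1 - z / (x + y)) • o + (z / (x + y)) • q = o + (x + y)⁻¹ • (z • (q - o)) := by
        match_scalars <;> field_simp
        ring
      rw [h1, h]
      match_scalars <;> field_simp
      ring

/-- The planar cross product. -/
def cross (a b : EuclideanSpace ℝ (Fin 2)) : ℝ := a 0 * b 1 - a 1 * b 0

/-- The linear dependence of three vectors in the plane. -/
theorem cross_smul_eq (a b c : EuclideanSpace ℝ (Fin 2)) :
    cross a c • b = cross b c • a + cross a b • c := by
  ext i
  fin_cases i <;> simp [cross] <;> ring

/-- The angle between `a` and `b` from their coordinates along and across `c`. -/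
theorem norm_sq_mul_cross (a b c : EuclideanSpace ℝ (Fin 2)) :
    (c 0 ^ 2 + c 1 ^ 2) * cross a b =
      inner ℝ c a * cross c b - cross c a * inner ℝ c b := by
  simp [cross, PiLp.inner_apply, Fin.sum_univ_two]
  ring

/-- The points of a planar set in convex position, other than a point `o`, can be listed by angle
around `o`. A line separates `o` from the others, so the angle can be measured by a slope. -/
theorem exists_sorted_around {n : ℕ} {P : Finset (EuclideanSpace ℝ (Fin 2))}
    (hP : ∀ p ∈ P, p ∉ convexHull ℝ ((P : Set (EuclideanSpace ℝ (Fin 2))) \ {p}))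
    (hcard : P.card = n + 1) :
    ∃ o ∈ P, ∃ q : Fin n → EuclideanSpace ℝ (Fin 2), (∀ i, q i ∈ P) ∧ (∀ i, q i ≠ o) ∧
      ∀ i j, i < j → 0 < cross (q i - o) (q j - o) := by
  classical
  obtain ⟨o, ho⟩ := Finset.card_pos.1 (by omega : 0 < P.card)
  have hfin : ((P : Set (EuclideanSpace ℝ (Fin 2))) \ {o}).Finite :=
    P.finite_toSet.subset Set.sdiff_subset
  obtain ⟨g, u, hgo, hg⟩ := geometric_hahn_banach_point_closed
    (convex_convexHull ℝ _) (hfin.isCompact_convexHull ℝ).isClosed (hP o ho)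
  set c := (InnerProductSpace.toDual ℝ _).symm g with hc
  have hpos : ∀ p ∈ P.erase o, 0 < inner ℝ c (p - o) := by
    intro p hp
    have h1 := hg p (subset_convexHull ℝ _ (by simpa [and_comm] using hp))
    have h2 : inner ℝ c (p - o) = g (p - o) := by simp [hc]
    rw [h2, map_sub]
    linarith
  set slope : EuclideanSpace ℝ (Fin 2) → ℝ := fun p => cross c (p - o) / inner ℝ c (p - o)
  have hslope : ∀ p ∈ P.erase o, ∀ p' ∈ P.erase o, slope p < slope p' →
      0 < cross (p - o) (p' - o) := by
    intro p hp p' hp' hlt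
    have h1 := hpos p hp
    have h2 := hpos p' hp'
    rw [div_lt_div_iff₀ h1 h2] at hlt
    have h3 := norm_sq_mul_cross (p - o) (p' - o) c
    have h4 : 0 < (c 0 ^ 2 + c 1 ^ 2) * cross (p - o) (p' - o) := by rw [h3]; linarith
    exact pos_of_mul_pos_right h4 (by positivity)
  -- equal slopes would put the nearer point on the segment from `o` to the farther one
  have hne : ∀ p ∈ P.erase o, ∀ p' ∈ P.erase o, p ≠ p' → slope p = slope p' →
      inner ℝ c (p - o) ≤ inner ℝ c (p' - o) → False := by
    intro p hp p' hp' hpp heq hle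
    have h1 := hpos p hp
    have h2 := hpos p' hp'
    have h3 := norm_sq_mul_cross (p - o) (p' - o) c
    rw [div_eq_div_iff h1.ne' h2.ne'] at heq
    set v := p - o with hv
    set w := p' - o with hw
    have hc0 : 0 < c 0 ^ 2 + c 1 ^ 2 := by
      by_contra! h
      have e0 : c 0 = 0 := by nlinarith [sq_nonneg (c 0), sq_nonneg (c 1)]
      have e1 : c 1 = 0 := by nlinarith [sq_nonneg (c 0), sq_nonneg (c 1)]
      simp [PiLp.inner_apply, Fin.sum_univ_two, e0, e1] at h1
    have hcr : cross v w = 0 := by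
      have : (c 0 ^ 2 + c 1 ^ 2) * cross v w = 0 := by rw [h3]; linarith
      exact (mul_eq_zero.1 this).resolve_left hc0.ne'
    have hvw : inner ℝ c w • v = inner ℝ c v • w := by
      ext i
      simp only [cross] at hcr
      fin_cases i <;> simp [PiLp.inner_apply, Fin.sum_univ_two]
      · linear_combination c 1 * hcr
      · linear_combination -c 0 * hcr
    have hmem : p ∈ segment ℝ o p' := by
      refine ⟨1 - inner ℝ c v / inner ℝ c w, inner ℝ c v / inner ℝ c w, ?_, by positivity,
        by ring, ?_⟩
      · rw [sub_nonneg, div_le_one h2]; exact hle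
      · have : v = (inner ℝ c v / inner ℝ c w) • w := by
          rw [div_eq_inv_mul, ← smul_smul, ← hvw, smul_smul, inv_mul_cancel₀ h2.ne', one_smul]
        have hp_eq : p = o + (inner ℝ c v / inner ℝ c w) • w := by rw [← this, hv]; abel
        refine Eq.trans ?_ hp_eq.symm
        generalize inner ℝ c v / inner ℝ c w = t
        rw [hw]
        module
    refine hP p (Finset.mem_of_mem_erase hp)
      ((convex_convexHull ℝ _).segment_subset (subset_convexHull ℝ _ ?_)
        (subset_convexHull ℝ _ ?_) hmem)
    · exact ⟨ho, fun h => (Finset.ne_of_mem_erase hp) h.symm⟩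
    · exact ⟨Finset.mem_of_mem_erase hp', fun h => hpp h.symm⟩
  have hinj : Set.InjOn slope (P.erase o : Finset _) := by
    intro p hp p' hp' heq
    by_contra hpp
    rcases le_total (inner ℝ c (p - o)) (inner ℝ c (p' - o)) with h | h
    · exact hne p hp p' hp' hpp heq h
    · exact hne p' hp' p hp (Ne.symm hpp) heq.symm h
  have hcard' : ((P.erase o).image slope).card = n := by
    rw [Finset.card_image_of_injOn hinj, Finset.card_erase_of_mem ho, hcard, Nat.add_sub_cancel]
  have hex : ∀ i : Fin n, ∃ p ∈ P.erase o,
      slope p = ((P.erase o).image slope).orderEmbOfFin hcard' i := fun i =>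
    Finset.mem_image.1 (Finset.orderEmbOfFin_mem _ hcard' i)
  choose q hq hqs using hex
  refine ⟨o, ho, q, fun i => Finset.mem_of_mem_erase (hq i),
    fun i => Finset.ne_of_mem_erase (hq i), fun i j hij => hslope _ (hq i) _ (hq j) ?_⟩
  rw [hqs, hqs]
  exact (OrderEmbedding.lt_iff_lt _).2 hij

/-- In `2 s + 2` points in convex position, no `s` halfplanes cut off the alternate ones: a halfplane
cutting off two of them would contain the segment between them, which crosses the segment between two
of the points to be kept. -/
theorem not_isShattered_plane {s : ℕ} {P : Finset (EuclideanSpace ℝ (Fin 2))}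
    (hcard : P.card = 2 * s + 2) : ¬ IsShattered (polytopes 2 s) P := by
  intro hS
  have hP : ∀ p ∈ P, p ∉ convexHull ℝ ((P : Set (EuclideanSpace ℝ (Fin 2))) \ {p}) := by
    intro p hp hmem
    obtain ⟨e, he, heP⟩ := hS (↑P \ {p}) Set.sdiff_subset
    have hpe : p ∈ e := convexHull_min (heP ▸ Set.inter_subset_left) (convex_polytope he) hmem
    have : p ∈ (P : Set (EuclideanSpace ℝ (Fin 2))) \ {p} := heP ▸ ⟨hpe, hp⟩
    exact this.2 rfl
  obtain ⟨o, ho, q, hq, hqo, hcross⟩ := exists_sorted_around (n := 2 * s + 1) hP hcard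
  have hqinj : ∀ i j, i < j → q i ≠ q j := by
    intro i j hij h
    have := hcross i j hij
    rw [h] at this
    simp [cross, mul_comm] at this
  -- the points of even index are to be cut off, one halfplane for each
  set ev : Fin (s + 1) → Fin (2 * s + 1) := fun a => ⟨2 * a.1, by omega⟩ with hev
  obtain ⟨e, he, heP⟩ := hS (↑P \ Set.range (q ∘ ev)) Set.sdiff_subset
  have hcv := convex_polytope he
  obtain ⟨m, hm, h, hh, rfl⟩ := he
  have hout : ∀ a, ∃ i, q (ev a) ∉ h i := by
    intro a
    by_contra! H
    have : q (ev a) ∈ (P : Set (EuclideanSpace ℝ (Fin 2))) \ Set.range (q ∘ ev) :=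
      heP ▸ ⟨Set.mem_iInter.2 H, hq _⟩
    exact this.2 ⟨a, rfl⟩
  choose k hk using hout
  obtain ⟨a, b, hab, hkab⟩ : ∃ a b, a < b ∧ k a = k b := by
    obtain ⟨a, b, hne, heq⟩ := Fintype.exists_ne_map_eq_of_card_lt k (by simp; omega)
    rcases lt_or_gt_of_ne hne with h | h
    · exact ⟨a, b, h, heq⟩
    · exact ⟨b, a, h, heq.symm⟩
  have hab' : a.1 < b.1 := hab
  set c : Fin (2 * s + 1) := ⟨2 * a.1 + 1, by omega⟩ with hcdef
  have hac : ev a < c := by simp [hev, hcdef, Fin.lt_def]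
  have hcb : c < ev b := by simp only [hev, hcdef, Fin.lt_def]; omega
  have hoe : o ∈ ⋂ i, h i := by
    have : o ∈ (⋂ i, h i) ∩ (P : Set (EuclideanSpace ℝ (Fin 2))) := by
      rw [heP]
      exact ⟨ho, by rintro ⟨i, hi⟩; exact hqo _ hi⟩
    exact this.1
  have hce : q c ∈ ⋂ i, h i := by
    have : q c ∈ (⋂ i, h i) ∩ (P : Set (EuclideanSpace ℝ (Fin 2))) := by
      rw [heP]
      refine ⟨hq c, ?_⟩
      rintro ⟨i, hi⟩
      have hne : ev i ≠ c := by
        intro h0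
        have := congrArg Fin.val h0
        simp only [hev, hcdef] at this
        omega
      rcases lt_or_gt_of_ne hne with h0 | h0
      · exact hqinj _ _ h0 hi
      · exact hqinj _ _ h0 hi.symm
    exact this.1
  rcases mem_convexHull_or_segments_meet (hcross _ _ hac) (hcross _ _ hcb)
    (hcross _ _ (hac.trans hcb)) (cross_smul_eq _ _ _) with hmem | ⟨x, hx1, hx2⟩
  · refine hP _ (hq c) (convexHull_mono ?_ hmem)
    rintro x (rfl | rfl | rfl)
    · exact ⟨ho, fun h0 => hqo c h0.symm⟩
    · exact ⟨hq _, hqinj _ _ hac⟩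
    · exact ⟨hq _, fun h0 => hqinj _ _ hcb h0.symm⟩
  · have h1 : x ∈ h (k a) := Set.mem_iInter.1 (hcv.segment_subset hoe hce hx1) _
    exact (convex_compl_closedHalfspace (hh (k a))).segment_subset (hk a)
      (by rw [hkab]; exact hk b) hx2 h1

/-! ### Permutation networks and orthants -/

/-- A permutation network on `2 ^ n` points. There is one switch `(j, u, v)` for each binary string
`u` of length `j` and `v` of length `n - 1 - j`, and every setting `σ` of the switches is realised by
points `(x y, y)` with `y < 2 ^ n`: the box of the points with abscissa starting with the digits
`u 0` and ordinate starting with `v 0` is met exactly when the switch is on. Strings are encoded as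
numbers, prefixes by division by powers of `2`.

The induction routes the points through the last digit of `y`: the switch `(0, v)` decides which of
the ordinates `v 0` and `v 1` receives the leading digit `0` in the abscissa, and for either leading
digit the rest is a network on the `2 ^ (n - 1)` strings `v`. -/
theorem exists_switching (n : ℕ) (σ : ℕ → ℕ → ℕ → Prop) :
    ∃ x : ℕ → ℕ, (∀ y, x y < 2 ^ n) ∧ ∀ j < n, ∀ u < 2 ^ j, ∀ v < 2 ^ (n - 1 - j),
      ((∃ y < 2 ^ n, x y / 2 ^ (n - 1 - j) = 2 * u ∧ y / 2 ^ j = 2 * v) ↔ σ j u v) := by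
  classical
  induction n generalizing σ with
  | zero => exact ⟨fun _ => 0, by simp, by simp⟩
  | succ n ih =>
    choose X hX hXσ using fun a : ℕ => ih fun j u v => σ (j + 1) (a * 2 ^ j + u) v
    -- the leading digit of the abscissa of `y`
    set c : ℕ → ℕ := fun y => if (y % 2 = 0 ↔ σ 0 0 (y / 2)) then 0 else 1 with hc
    have hc2 : ∀ y, c y < 2 := fun y => by simp only [hc]; split_ifs <;> norm_num
    have hsel : ∀ a < 2, ∀ v, ∃ y, y / 2 = v ∧ c y = a := by
      intro a ha v
      by_cases hv : σ 0 0 v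
      · refine ⟨2 * v + a, by omega, ?_⟩
        have e1 : (2 * v + a) / 2 = v := by omega
        simp only [hc, e1, hv, iff_true]
        interval_cases a <;> simp
      · refine ⟨2 * v + (1 - a), by omega, ?_⟩
        have e1 : (2 * v + (1 - a)) / 2 = v := by omega
        simp only [hc, e1, hv, iff_false]
        interval_cases a <;> simp
    refine ⟨fun y => c y * 2 ^ n + X (c y) (y / 2), fun y => ?_, ?_⟩
    · have h1 := hc2 y
      have h2 := hX (c y) (y / 2)
      have : c y * 2 ^ n ≤ 1 * 2 ^ n := Nat.mul_le_mul_right _ (by omega)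
      simp only [pow_succ]
      omega
    · intro j hj u hu v hv
      rcases j with _ | j
      · have hu0 : u = 0 := by simpa using hu
        subst hu0
        simp only [Nat.add_sub_cancel, Nat.sub_zero, pow_zero, Nat.div_one] at hv ⊢
        have hdiv : ∀ y, (c y * 2 ^ n + X (c y) (y / 2)) / 2 ^ n = c y := fun y => by
          rw [mul_comm, Nat.mul_add_div (by positivity), Nat.div_eq_of_lt (hX _ _), add_zero]
        simp only [hdiv]
        have h1 : 2 * v % 2 = 0 := by omega
        have h2 : 2 * v / 2 = v := by omega
        constructor
        · rintro ⟨y, -, hcy, rfl⟩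
          simpa [hc] using hcy
        · intro h
          exact ⟨2 * v, by rw [pow_succ]; omega, by simp [hc, h], rfl⟩
      · have hj' : j < n := by omega
        have en : n + 1 - 1 - (j + 1) = n - 1 - j := by omega
        rw [en] at hv ⊢
        -- the leading digit of `u`
        set a := u / 2 ^ j with ha
        have ha2 : a < 2 := by
          rw [ha, Nat.div_lt_iff_lt_mul (by positivity), mul_comm, ← pow_succ]; exact hu
        have hu' : u % 2 ^ j < 2 ^ j := Nat.mod_lt _ (by positivity)
        have hua : a * 2 ^ j + u % 2 ^ j = u := by rw [mul_comm]; exact Nat.div_add_mod _ _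
        have hpow : (2 : ℕ) ^ n = 2 ^ (n - 1 - j) * (2 * 2 ^ j) := by
          rw [← pow_succ', ← pow_add]; congr 1; omega
        have hdiv : ∀ y, (c y * 2 ^ n + X (c y) (y / 2)) / 2 ^ (n - 1 - j) =
            c y * (2 * 2 ^ j) + X (c y) (y / 2) / 2 ^ (n - 1 - j) := fun y => by
          rw [hpow, show c y * (2 ^ (n - 1 - j) * (2 * 2 ^ j)) =
            2 ^ (n - 1 - j) * (c y * (2 * 2 ^ j)) by ring, Nat.mul_add_div (by positivity)]
        have hlt : ∀ b w, X b w / 2 ^ (n - 1 - j) < 2 * 2 ^ j := fun b w => by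
          rw [Nat.div_lt_iff_lt_mul (by positivity), mul_comm, ← hpow]; exact hX _ _
        have hxiff : ∀ y, (c y * 2 ^ n + X (c y) (y / 2)) / 2 ^ (n - 1 - j) = 2 * u ↔
            c y = a ∧ X (c y) (y / 2) / 2 ^ (n - 1 - j) = 2 * (u % 2 ^ j) := fun y => by
          rw [hdiv]
          have h1 := hlt (c y) (y / 2)
          have h2 := hc2 y
          generalize X (c y) (y / 2) / 2 ^ (n - 1 - j) = q at *
          generalize c y = b at *
          generalize u % 2 ^ j = r at *
          rw [← hua]
          generalize 2 ^ j = p at *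
          interval_cases a <;> interval_cases b <;> omega
        have hyiff : ∀ y, y / 2 ^ (j + 1) = y / 2 / 2 ^ j := fun y => by
          rw [pow_succ', Nat.div_div_eq_div_mul]
        simp only [hxiff, hyiff]
        have := hXσ a j hj' (u % 2 ^ j) hu' v hv
        rw [hua] at this
        rw [← this]
        constructor
        · rintro ⟨y, hy, ⟨hca, hx⟩, hyv⟩
          exact ⟨y / 2, by rw [pow_succ] at hy; omega, by rwa [hca] at hx, hyv⟩
        · rintro ⟨w, hw, hx, hwv⟩
          obtain ⟨y, rfl, hca⟩ := hsel a ha2 w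
          exact ⟨y, by rw [pow_succ]; omega, ⟨hca, by rwa [hca]⟩, hwv⟩

/-- If the unions of `s` orthants `{p | p ≤ c}` cut every subset out of a finite subset of `ℕ ^ d`, then
some set of the same size is shattered by polytopes with `s` facets. Raising a large number `K` to the
coordinates makes an orthant into a halfspace, `∑ K ^ (M - c k) K ^ p k < K ^ (M + 1)`, and the
polytope is the complement of the union. -/
theorem exists_isShattered_of_orthants {ι : Type*} [Fintype ι] {d s M : ℕ} (hd : 1 ≤ d)
    (p : ι → Fin d → ℕ)
    (hp : ∀ S : Set ι, ∃ c : Fin s → Fin d → ℕ, (∀ i k, c i k ≤ M) ∧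
      ∀ z, (∃ i, ∀ k, p z k ≤ c i k) ↔ z ∈ S) :
    ∃ P : Finset (EuclideanSpace ℝ (Fin d)), P.card = Fintype.card ι ∧
      IsShattered (polytopes d s) P := by
  classical
  set K : ℝ := d + 1 with hK
  have hK1 : (1 : ℝ) < K := by
    have : (1 : ℝ) ≤ d := by exact_mod_cast hd
    linarith
  have hK0 : 0 < K := by linarith
  set φ : ι → EuclideanSpace ℝ (Fin d) := fun z => WithLp.toLp 2 fun k => K ^ p z k with hφ
  set a : (Fin d → ℕ) → EuclideanSpace ℝ (Fin d) :=
    fun c => WithLp.toLp 2 fun k => K ^ (M - c k) with ha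
  have hinner : ∀ c z, inner ℝ (-a c) (φ z) = -∑ k, K ^ (M - c k) * K ^ p z k := by
    intro c z
    rw [inner_neg_left]
    simp [ha, hφ, PiLp.inner_apply, mul_comm]
  have ha0 : ∀ c, -a c ≠ 0 := by
    intro c h
    have := congrArg (fun v : EuclideanSpace ℝ (Fin d) => v ⟨0, hd⟩) h
    simp [ha] at this
    exact hK0.ne' this.1
  -- one violated constraint outweighs all the satisfied ones
  have hsum : ∀ (c : Fin d → ℕ) (z : ι), (∀ k, c k ≤ M) →
      ((∀ k, p z k ≤ c k) ↔ ¬ (-∑ k, K ^ (M - c k) * K ^ p z k ≤ -K ^ (M + 1))) := by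
    intro c z hc
    rw [neg_le_neg_iff, not_le]
    constructor
    · intro h
      calc ∑ k, K ^ (M - c k) * K ^ p z k ≤ ∑ k : Fin d, K ^ M := by
            refine Finset.sum_le_sum fun k _ => ?_
            rw [← pow_add]
            have := hc k
            have := h k
            exact pow_le_pow_right₀ hK1.le (by omega)
        _ = d * K ^ M := by simp
        _ < (d + 1) * K ^ M := by
            have : 0 < K ^ M := by positivity
            linarith
        _ = K ^ (M + 1) := by rw [pow_succ', hK]
    · intro h k
      by_contra! hk
      refine h.not_ge ?_
      calc K ^ (M + 1) ≤ K ^ (M - c k) * K ^ p z k := by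
            rw [← pow_add]
            have := hc k
            exact pow_le_pow_right₀ hK1.le (by omega)
        _ ≤ _ := Finset.single_le_sum (f := fun k => K ^ (M - c k) * K ^ p z k)
            (fun k _ => by positivity) (Finset.mem_univ k)
  have hcut : ∀ S : Set ι, ∃ e ∈ polytopes d s, ∀ z, φ z ∈ e ↔ z ∉ S := by
    intro S
    obtain ⟨c, hcM, hc⟩ := hp S
    refine ⟨⋂ i, {x | inner ℝ (-a (c i)) x ≤ -K ^ (M + 1)},
      ⟨s, le_rfl, _, fun i => ⟨_, _, ha0 (c i), rfl⟩, rfl⟩, fun z => ?_⟩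
    rw [← hc z]
    simp only [Set.mem_iInter, Set.mem_ofPred_eq, hinner, not_exists]
    refine forall_congr' fun i => ?_
    rw [hsum (c i) z (hcM i), not_not]
  have hinj : Function.Injective φ := by
    intro z z' h
    obtain ⟨e, -, he⟩ := hcut {z}
    have h1 := he z
    have h2 := he z'
    rw [h] at h1
    by_contra hne
    exact (h1.1 (h2.2 (by simpa using Ne.symm hne))) rfl
  refine ⟨Finset.univ.map ⟨φ, hinj⟩, by simp, ?_⟩
  intro T hT
  obtain ⟨e, he, heS⟩ := hcut (φ ⁻¹' T)ᶜ
  refine ⟨e, he, ?_⟩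
  ext x
  constructor
  · rintro ⟨hxe, hx⟩
    obtain ⟨z, rfl⟩ : ∃ z, φ z = x := by simpa using hx
    simpa using (heS z).1 hxe
  · intro hx
    obtain ⟨z, rfl⟩ : ∃ z, φ z = x := by simpa using hT hx
    exact ⟨(heS z).2 (by simpa using hx), hT hx⟩

/-! ### The lower bound by stabbing boxes -/

theorem polytopes_mono (d : ℕ) {s s' : ℕ} (h : s ≤ s') : polytopes d s ⊆ polytopes d s' := by
  rintro K ⟨m, hm, hK⟩
  exact ⟨m, hm.trans h, hK⟩

theorem IsShattered.mono {V : Type*} {E E' : Set (Set V)} {S : Finset V}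
    (h : IsShattered E S) (hE : E ⊆ E') : IsShattered E' S := fun T hT =>
  let ⟨e, he, heS⟩ := h T hT
  ⟨e, hE he, heS⟩

/-- Shattering by stabbing boxes: if for each set `S` of boxes in `ℕ ^ D` there are `s` points that
meet exactly the boxes of `S`, then polytopes with `s` facets shatter a set of as many points in
dimension `2 D`. A box becomes the point of its lower and (reversed) upper end points, one coordinate
each, and the boxes containing a point become the points of an orthant. -/
theorem exists_isShattered_of_boxes {ι : Type*} [Fintype ι] {d D s M : ℕ} (hd : 1 ≤ d)
    (hD : 2 * D ≤ d) (lo hi : ι → Fin D → ℕ)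
    (h : ∀ S : Set ι, ∃ q : Fin s → Fin D → ℕ, (∀ i e, q i e < M) ∧
      ∀ z, (∃ i, ∀ e, lo z e ≤ q i e ∧ q i e < hi z e) ↔ z ∈ S) :
    ∃ P : Finset (EuclideanSpace ℝ (Fin d)), P.card = Fintype.card ι ∧
      IsShattered (polytopes d s) P := by
  refine exists_isShattered_of_orthants (M := M) hd
    (fun z k => if hk : k.1 / 2 < D then
      (if k.1 % 2 = 0 then lo z ⟨k.1 / 2, hk⟩ else M - hi z ⟨k.1 / 2, hk⟩) else 0) fun S => ?_
  obtain ⟨q, hqM, hq⟩ := h S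
  refine ⟨fun i k => if hk : k.1 / 2 < D then
      (if k.1 % 2 = 0 then q i ⟨k.1 / 2, hk⟩ else M - (q i ⟨k.1 / 2, hk⟩ + 1)) else 0, ?_, ?_⟩
  · intro i k
    dsimp only
    split_ifs
    · exact (hqM _ _).le
    · omega
    · omega
  · intro z
    rw [← hq z]
    refine exists_congr fun i => ⟨fun H e => ?_, fun H k => ?_⟩
    · have h0 := H ⟨2 * e.1, by omega⟩
      have h1 := H ⟨2 * e.1 + 1, by omega⟩
      have e0 : 2 * e.1 / 2 = e.1 := by omega
      have e1 : (2 * e.1 + 1) / 2 = e.1 := by omega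
      have e2 : 2 * e.1 % 2 = 0 := by omega
      have e3 : ¬ (2 * e.1 + 1) % 2 = 0 := by omega
      simp only [e0, e1, e2, e3, Fin.is_lt, dif_pos, if_true, if_false, Fin.eta] at h0 h1
      have := hqM i e
      omega
    · dsimp only
      split_ifs with hk hk2
      · exact (H _).1
      · have := (H ⟨k.1 / 2, hk⟩).2
        omega
      · exact le_rfl

/-- The boxes of `r` permutation networks, all of them sharing the ordinate and each with an abscissa of
its own, can be stabbed independently of each other by the same `2 ^ n` points. -/
theorem exists_isShattered_switching {d r n s : ℕ} (hr : 2 * (r + 1) ≤ d) (hs : 2 ^ n ≤ s) :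
    ∃ P : Finset (EuclideanSpace ℝ (Fin d)), P.card = r * (n * 2 ^ (n - 1)) ∧
      IsShattered (polytopes d s) P := by
  classical
  suffices H : ∃ P : Finset (EuclideanSpace ℝ (Fin d)),
      P.card = Fintype.card (Fin r × Fin n × Fin (2 ^ (n - 1))) ∧
      IsShattered (polytopes d (2 ^ n)) P by
    obtain ⟨P, hP, hPS⟩ := H
    exact ⟨P, by simpa using hP, hPS.mono (polytopes_mono d hs)⟩
  -- The triple `(i, j, w)` stands for the switch `(j, u, v)` of the `i`-th network, where
  -- `w = 2 ^ j * v + u`.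
  refine exists_isShattered_of_boxes (D := r + 1) (M := 2 ^ n) (by omega) hr
    (fun z => Fin.cons (2 * (z.2.2 / 2 ^ z.2.1.1) * 2 ^ z.2.1.1)
      fun i => if i = z.1 then 2 * (z.2.2 % 2 ^ z.2.1.1) * 2 ^ (n - 1 - z.2.1) else 0)
    (fun z => Fin.cons ((2 * (z.2.2 / 2 ^ z.2.1.1) + 1) * 2 ^ z.2.1.1)
      fun i => if i = z.1 then (2 * (z.2.2 % 2 ^ z.2.1.1) + 1) * 2 ^ (n - 1 - z.2.1) else 2 ^ n)
    fun S => ?_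
  choose x hx hxσ using fun i : Fin r => exists_switching n fun j u v =>
    ∃ z ∈ S, z.1 = i ∧ z.2.1.1 = j ∧ z.2.2.1 = 2 ^ j * v + u
  refine ⟨fun y => Fin.cons y.1 fun i => x i y.1, ?_, ?_⟩
  · intro y e
    refine Fin.cases ?_ (fun i => ?_) e
    · simp
    · simpa using hx i y
  · rintro ⟨i, j, w⟩
    have hu : w.1 % 2 ^ j.1 < 2 ^ j.1 := Nat.mod_lt _ (by positivity)
    have hv : w.1 / 2 ^ j.1 < 2 ^ (n - 1 - j) := by
      rw [Nat.div_lt_iff_lt_mul (by positivity), ← pow_add]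
      refine w.2.trans_le (le_of_eq ?_)
      congr 1
      have := j.2
      omega
    have key := hxσ i j j.2 _ hu _ hv
    have hS : (∃ z ∈ S, z.1 = i ∧ z.2.1.1 = j.1 ∧
        z.2.2.1 = 2 ^ j.1 * (w.1 / 2 ^ j.1) + w.1 % 2 ^ j.1) ↔ (i, j, w) ∈ S := by
      rw [Nat.div_add_mod]
      constructor
      · rintro ⟨⟨i', j', w'⟩, hz, rfl, h1, h2⟩
        rwa [← Fin.ext h1, ← Fin.ext h2]
      · intro h
        exact ⟨_, h, rfl, rfl, rfl⟩
    rw [← hS, ← key]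
    have hdiv : ∀ a b c : ℕ, (b * 2 ^ c ≤ a ∧ a < (b + 1) * 2 ^ c) ↔ a / 2 ^ c = b := by
      intro a b c
      rw [Nat.div_eq_iff (by positivity), add_mul, one_mul]
      have : 0 < 2 ^ c := by positivity
      omega
    have hbox : ∀ y : Fin (2 ^ n), (∀ e : Fin (r + 1),
        (Fin.cons (2 * (w.1 / 2 ^ j.1) * 2 ^ j.1)
          (fun i' => if i' = i then 2 * (w.1 % 2 ^ j.1) * 2 ^ (n - 1 - j.1) else 0) :
          Fin (r + 1) → ℕ) e ≤ (Fin.cons y.1 fun i => x i y.1 : Fin (r + 1) → ℕ) e ∧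
        (Fin.cons y.1 fun i => x i y.1 : Fin (r + 1) → ℕ) e <
        (Fin.cons ((2 * (w.1 / 2 ^ j.1) + 1) * 2 ^ j.1)
          (fun i' => if i' = i then (2 * (w.1 % 2 ^ j.1) + 1) * 2 ^ (n - 1 - j.1) else 2 ^ n) :
          Fin (r + 1) → ℕ) e) ↔
        x i y / 2 ^ (n - 1 - j.1) = 2 * (w.1 % 2 ^ j.1) ∧ y.1 / 2 ^ j.1 = 2 * (w.1 / 2 ^ j.1) := by
      intro y
      rw [Fin.forall_fin_succ, ← hdiv, ← hdiv]
      simp only [Fin.cons_zero, Fin.cons_succ]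
      rw [and_comm (a := _ ∧ _) (b := _ ∧ y.1 < _)]
      refine and_congr_right fun _ => ⟨fun H => by simpa using H i, fun H i' => ?_⟩
      split_ifs with hi
      · subst hi; exact H
      · exact ⟨Nat.zero_le _, hx i' y⟩
    simp only [hbox]
    exact ⟨fun ⟨y, hy⟩ => ⟨y, y.2, hy⟩, fun ⟨y, hy, H⟩ => ⟨⟨y, hy⟩, H⟩⟩

/-- The standard basis is shattered by single orthants. This serves `s = 1`, where the network has no
switch. -/
theorem exists_isShattered_card_eq_dim {d s : ℕ} (hd : 1 ≤ d) (hs : 1 ≤ s) :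
    ∃ P : Finset (EuclideanSpace ℝ (Fin d)), P.card = d ∧ IsShattered (polytopes d s) P := by
  classical
  suffices H : ∃ P : Finset (EuclideanSpace ℝ (Fin d)), P.card = Fintype.card (Fin d) ∧
      IsShattered (polytopes d 1) P by
    obtain ⟨P, hP, hPS⟩ := H
    exact ⟨P, by simpa using hP, hPS.mono (polytopes_mono d hs)⟩
  refine exists_isShattered_of_orthants (M := 1) hd (fun z k => if k = z then 1 else 0) fun S => ?_
  refine ⟨fun _ k => if k ∈ S then 1 else 0, fun _ k => by dsimp only; split_ifs <;> simp,
    fun z => ⟨fun ⟨_, H⟩ => ?_, fun hz => ⟨0, fun k => ?_⟩⟩⟩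
  · by_contra hz
    simpa [hz] using H z
  · dsimp only
    split_ifs with h1 h2 <;> simp_all

/-- The lower bound on the VC-dimension, from `d / 2 - 1` networks on `2 ^ n` points, `n` being the
integer part of `log₂ s`. -/
theorem exists_isShattered_card_ge {d s : ℕ} (hd : 4 ≤ d) (hs : 1 ≤ s) :
    ∃ P : Finset (EuclideanSpace ℝ (Fin d)), IsShattered (polytopes d s) P ∧
      (1 / 40 : ℝ) * (d * s * Real.log (s + 1)) ≤ P.card := by
  rcases hs.eq_or_lt with rfl | hs2
  · obtain ⟨P, hP, hPS⟩ := exists_isShattered_card_eq_dim (d := d) (s := 1) (by omega) le_rfl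
    refine ⟨P, hPS, ?_⟩
    rw [hP]
    have hlog : Real.log (((1 : ℕ) : ℝ) + 1) ≤ 1 := by
      have := Real.log_two_lt_d9
      norm_num at this ⊢
      linarith
    calc (1 / 40 : ℝ) * (d * (1 : ℕ) * Real.log (((1 : ℕ) : ℝ) + 1))
        ≤ 1 * (d * (1 : ℕ) * 1) := by gcongr; norm_num
      _ = d := by simp
  · set n := Nat.log 2 s with hn
    have hn1 : 1 ≤ n := Nat.le_log_of_pow_le (by norm_num) (by omega)
    have hns : 2 ^ n ≤ s := Nat.pow_log_le_self 2 (by omega)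
    have hsn : s + 1 ≤ 2 ^ (n + 1) := Nat.lt_pow_succ_log_self (by norm_num) s
    obtain ⟨r, hr⟩ : ∃ r, d / 2 = r + 1 := ⟨d / 2 - 1, by omega⟩
    obtain ⟨m, hm⟩ : ∃ m, n = m + 1 := ⟨n - 1, by omega⟩
    obtain ⟨P, hP, hPS⟩ := exists_isShattered_switching (d := d) (r := r) (n := n) (s := s)
      (by omega) hns
    refine ⟨P, hPS, ?_⟩
    rw [hP, hm, Nat.add_sub_cancel]
    -- equality holds for `d = 5`, `r = 1`
    have hdr : (d : ℝ) ≤ 5 * r := by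
      have : d ≤ 5 * r := by omega
      exact_mod_cast this
    have hsm : (s : ℝ) ≤ 4 * 2 ^ m := by
      have : s ≤ 4 * 2 ^ m := by
        rw [hm] at hsn
        have : 2 ^ (m + 1 + 1) = 4 * 2 ^ m := by ring
        omega
      exact_mod_cast this
    have hlog : Real.log (s + 1) ≤ 2 * (m + 1) := by
      calc Real.log (s + 1) ≤ Real.log (2 ^ (n + 1)) :=
            Real.log_le_log (by positivity) (by exact_mod_cast hsn)
        _ = (m + 2) * Real.log 2 := by
            rw [Real.log_pow, hm]; push_cast; ring
        _ ≤ (m + 2) * 1 := by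
            have := Real.log_two_lt_d9
            gcongr
            linarith
        _ ≤ _ := by
            have : (0 : ℝ) ≤ m := Nat.cast_nonneg m
            linarith
    have hlog0 : 0 ≤ Real.log ((s : ℝ) + 1) :=
      Real.log_nonneg (by linarith [Nat.cast_nonneg (α := ℝ) s])
    calc (1 / 40 : ℝ) * (d * s * Real.log (s + 1))
        ≤ (1 / 40 : ℝ) * ((5 * r) * (4 * 2 ^ m) * (2 * (m + 1))) := by gcongr
      _ = _ := by push_cast; ring

end UnionRadon

theorem theorem4p1 :
    (∀ d s : ℕ, 1 ≤ d → 1 ≤ s →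
      ∃ l : ℕ, UnionRadon.vcDim (UnionRadon.polytopes d s) = (l : ℕ∞) ∧
        UnionRadon.f d s 1 = (l : ℕ∞) + 1) ∧
    (∀ s : ℕ, 1 ≤ s → UnionRadon.f 2 s 1 = ((2 * s + 2 : ℕ) : ℕ∞)) ∧
    (∃ c C : ℝ, 0 < c ∧ 0 < C ∧ ∀ d s : ℕ, 4 ≤ d → 1 ≤ s →
      ∃ n : ℕ, UnionRadon.f d s 1 = (n : ℕ∞) ∧
        c * ((d : ℝ) * (s : ℝ) * Real.log ((s : ℝ) + 1)) ≤ (n : ℝ) ∧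
        (n : ℝ) ≤ C * ((d : ℝ) * (s : ℝ) * Real.log ((s : ℝ) + 1))) := by
  refine ⟨fun d s hd hs => ?_, fun s hs => ?_, 1 / 40, 12, by norm_num, by norm_num,
    fun d s hd hs => ?_⟩
  · obtain ⟨l, -, h1, h2, -⟩ := UnionRadon.exists_vcDim_eq_and_f_eq hd fun S hS =>
      Nat.le_floor (UnionRadon.card_le_of_isShattered hs hS)
    exact ⟨l, h1, h2⟩
  · obtain ⟨l, hl, -, hf, hmax⟩ := UnionRadon.exists_vcDim_eq_and_f_eq (d := 2) (s := s)
      (N := 2 * s + 1) (by norm_num) fun S hS => by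
        by_contra! hlt
        obtain ⟨P, hPS, hP⟩ := Finset.exists_subset_card_eq (n := 2 * s + 2) hlt
        exact UnionRadon.not_isShattered_plane hP (hS.subset hPS)
    obtain ⟨P, hP, hPS⟩ := UnionRadon.exists_isShattered_plane hs
    have := hmax P hPS
    have hl' : l = 2 * s + 1 := by omega
    rw [hf, hl']
    push_cast
    rfl
  · obtain ⟨l, hl, -, hf, hmax⟩ := UnionRadon.exists_vcDim_eq_and_f_eq (d := d) (s := s)
      (by omega) fun S hS => Nat.le_floor (UnionRadon.card_le_of_isShattered hs hS)
    obtain ⟨P, hPS, hP⟩ := UnionRadon.exists_isShattered_card_ge hd hs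
    have hPl : (P.card : ℝ) ≤ l := by exact_mod_cast hmax P hPS
    have hd' : (4 : ℝ) ≤ d := by exact_mod_cast hd
    have hs' : (1 : ℝ) ≤ s := by exact_mod_cast hs
    have hlog : (1 / 2 : ℝ) ≤ Real.log (s + 1) := by
      have h1 := Real.log_two_gt_d9
      have h2 := Real.log_le_log (by norm_num) (show (2 : ℝ) ≤ s + 1 by linarith)
      linarith
    have hlu := (Nat.le_floor_iff (by positivity)).1 hl
    have hsl : (1 / 2 : ℝ) ≤ s * Real.log (s + 1) := by nlinarith
    refine ⟨l + 1, by rw [hf]; rfl, by push_cast; linarith, ?_⟩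
    push_cast
    have e1 : (5 : ℝ) * s * (d + 1) * Real.log (s + 1) =
      5 * (d + 1) * (s * Real.log (s + 1)) := by ring
    have e2 : (12 : ℝ) * (d * s * Real.log (s + 1)) = 12 * d * (s * Real.log (s + 1)) := by ring
    rw [e1] at hlu
    rw [e2]
    nlinarith
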